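/- For a nonempty lattice polytope $P\subseteq\mathbb{R}^n$ (the convex hull of a finite nonempty subset of $\mathbb{Z}^n$) put $E_P(m)=\#(mP\cap\mathbb{Z}^n)$ for integers $m\ge 0$; these are the values of the Ehrhart polynomial of $P$ at the non-negative integers. The Ehrhart series of $P$ is called log-concave if $E_P(m)>0$ for all $m\ge 0$ and $E_P(m)^2\ge E_P(m-1)E_P(m+1)$ for all $m\ge 1$. The polytope $P$ is IDP if for every integer $k\ge 1$ each point of $kP\cap\mathbb{Z}^n$ is a sum of $k$ points of $P\cap\mathbb{Z}^n$, and very ample if this holds for all sufficiently large $k$. Corollary. There exists a very ample lattice polytope whose Ehrhart series is not log-concave. More precisely, let $P\subseteq\mathbb{R}^7$ be the convex hull of the columns of $$\left[\begin{array}{rrrrrrrrrrrr} 1 & 1 & 1 & 1 & 0 & 0 & 0 & 0 & 0 & 0 & 0 & 0 \\ 1 & 1 & 0 & 0 & 1 & 1 & 0 & 0 & 0 & 0 & 0 & 0 \\ 0 & 0 & 0 & 0 & 1 & 1 & 1 & 1 & 0 & 0 & 0 & 0 \\ 0 & 0 & 0 & 0 & 0 & 0 & 1 & 1 & 1 & 1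 & 0 & 0 \\ 0 & 0 & 0 & 0 & 0 & 0 & 0 & 0 & 1 & 1 & 1 & 1 \\ 0 & 0 & 1 & 1 & 0 & 0 & 0 & 0 & 0 & 0 & 1 & 1 \\ 111 & 112 & 0 & 1 & 0 & 1 & 0 & 1 & 0 & 1 & 0 & 1 \end{array}\right].$$ Then $P$ is a lattice polytope that is very ample but not IDP, and its Ehrhart series is not log-concave. Moreover, the projection $f:\mathbb{R}^7\to\mathbb{R}^6$ forgetting the last coordinate makes $P$ a segmental fibration over the edge polytope $Q=\mathrm{conv}\{e_i+e_j : \{i,j\}\in E(C_6)\}$ of the cycle $C_6$ on $6$ vertices; that is, $P$ and $Q$ are lattice polytopes, $f(P)=Q$, $f$ maps lattice points of $P$ to lattice points of $Q$, and for every lattice point $x$ of $Q$ the fibre $P\cap f^{-1}(x)$ is a segment of positive length whose endpoints are lattice points. -/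

import Mathlib

open scoped Pointwise

namespace LatticePolytope

/-- A real vector all of whose coordinates are integers, given by its integer coordinates. -/
def toReal {n : ℕ} (z : Fin n → ℤ) : Fin n → ℝ := fun i => (z i : ℝ)

/-- The lattice points `X ∩ ℤⁿ` of a subset `X` of `ℝⁿ`, as integer vectors. -/
def latticePoints {n : ℕ} (X : Set (Fin n → ℝ)) : Set (Fin n → ℤ) :=
  {z | toReal z ∈ X}

/-- A (nonempty) lattice polytope: the convex hull of a finite nonempty set of lattice points. -/
def IsLatticePolytope {n : ℕ} (P : Set (Fin n → ℝ)) : Prop :=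
  ∃ S : Finset (Fin n → ℤ), S.Nonempty ∧ P = convexHull ℝ (toReal '' (S : Set (Fin n → ℤ)))

/-- Every lattice point of the dilate `kP` is a sum of `k` lattice points of `P`. -/
def Decomposes {n : ℕ} (P : Set (Fin n → ℝ)) (k : ℕ) : Prop :=
  ∀ z ∈ latticePoints ((k : ℝ) • P),
    ∃ p : Fin k → (Fin n → ℤ), (∀ i, p i ∈ latticePoints P) ∧ z = ∑ i, p i

/-- The integer decomposition property. -/
def IsIDP {n : ℕ} (P : Set (Fin n → ℝ)) : Prop :=
  ∀ k : ℕ, 0 < k → Decomposes P k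

/-- Very ampleness: the decomposition property for all sufficiently large `k`. -/
def IsVeryAmple {n : ℕ} (P : Set (Fin n → ℝ)) : Prop :=
  ∃ K : ℕ, ∀ k : ℕ, K ≤ k → Decomposes P k

/-- The coefficient `E_P(m) = #(mP ∩ ℤⁿ)` of the Ehrhart series `∑ E_P(m) x ^ m`.
For `m = 0` the dilate is `{0}`, so that `E_P(0) = 1` for every nonempty `P`. -/
noncomputable def ehrhart {n : ℕ} (P : Set (Fin n → ℝ)) (m : ℕ) : ℕ :=
  (latticePoints ((m : ℝ) • P)).ncard

/-- Log-concavity of an infinite sequence; its entries are required to be positive. -/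
def IsLogConcave (a : ℕ → ℝ) : Prop :=
  (∀ m, 0 < a m) ∧ ∀ m, a m * a (m + 2) ≤ a (m + 1) ^ 2

/-- The Ehrhart series `E_P(0), E_P(1), E_P(2), …` is log-concave. -/
def EhrhartSeriesLogConcave {n : ℕ} (P : Set (Fin n → ℝ)) : Prop :=
  IsLogConcave fun m => (ehrhart P m : ℝ)

/-- The edge polytope of a graph: the convex hull of all `e_i + e_j` with `{i, j}` an edge. -/
def edgePolytope {n : ℕ} (G : SimpleGraph (Fin n)) : Set (Fin n → ℝ) :=
  convexHull ℝ {v | ∃ i j, G.Adj i j ∧ v = Pi.single i 1 + Pi.single j 1}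

/-- The affine map `f` exhibits `P` as a segmental fibration over `Q`: it maps `P` onto `Q`,
it maps lattice points of `P` to lattice points, and its fibre in `P` over each lattice point
of `Q` is a segment of positive length whose endpoints are lattice points. -/
structure IsSegmentalFibration {m n : ℕ} (f : (Fin m → ℝ) →ᵃ[ℝ] (Fin n → ℝ))
    (P : Set (Fin m → ℝ)) (Q : Set (Fin n → ℝ)) : Prop where
  isLatticePolytope_total : IsLatticePolytope P
  isLatticePolytope_base : IsLatticePolytope Q
  image_eq : f '' P = Q
  map_lattice : ∀ z ∈ latticePoints P, ∃ w ∈ latticePoints Q, f (toReal z) = toReal w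
  fibre : ∀ w ∈ latticePoints Q, ∃ u v : Fin m → ℤ, u ≠ v ∧
    {p | p ∈ P ∧ f p = toReal w} = segment ℝ (toReal u) (toReal v)

/-- The projection `ℝⁿ⁺¹ → ℝⁿ` that forgets the last coordinate. -/
def forgetLast (n : ℕ) : (Fin (n + 1) → ℝ) →ᵃ[ℝ] (Fin n → ℝ) :=
  (LinearMap.funLeft ℝ ℝ (Fin.castSucc : Fin n → Fin (n + 1))).toAffineMap

/-- The matrix whose columns span the example polytope. -/
def exampleMatrix : Matrix (Fin 7) (Fin 12) ℤ :=
  !![  1,   1, 1, 1, 0, 0, 0, 0, 0, 0, 0, 0;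
       1,   1, 0, 0, 1, 1, 0, 0, 0, 0, 0, 0;
       0,   0, 0, 0, 1, 1, 1, 1, 0, 0, 0, 0;
       0,   0, 0, 0, 0, 0, 1, 1, 1, 1, 0, 0;
       0,   0, 0, 0, 0, 0, 0, 0, 1, 1, 1, 1;
       0,   0, 1, 1, 0, 0, 0, 0, 0, 0, 1, 1;
     111, 112, 0, 1, 0, 1, 0, 1, 0, 1, 0, 1]

/-- The example polytope: the convex hull in `ℝ⁷` of the columns of `exampleMatrix`. -/
def examplePolytope : Set (Fin 7 → ℝ) :=
  convexHull ℝ (Set.range fun j : Fin 12 => toReal fun i => exampleMatrix i j)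

end LatticePolytope

/-!
Write `P` for the example polytope and `Q` for the edge polytope of the 6-cycle. Over each edge
of the cycle lie two columns of the matrix, at consecutive heights: `111, 112` over `{0, 1}` and
`0, 1` over the other edges. Since the cycle is even, the only relation among its edge vectors is
that the two perfect matchings have the same sum. Hence the ways to write a point `x` as a
nonnegative combination of edges are parametrized by the weight `s` of the edge `{0, 1}`, which
runs over an interval `[lower, upper]` whose ends are integers when `x` is integral. A combination
of total weight `k` reaches exactly the heights in `[111 s, 111 s + k]`, so the fibre of `kP` over
`x` is the segment of heights `[111 lower, 111 upper + k]`. This description,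
`mem_latticePoints_smul_iff`, drives everything else.

Sums of `k` lattice points of `P` are the points reached with an *integral* `s`
(`exists_sum_of_isWeight`). If `k ≥ 110`, the integral ranges `{111 s, …, 111 s + k}` cover the
whole fibre, so `P` is very ample; if `k = 3`, the fibre over the all-ones vector has the two
ranges `{0, …, 3}` and `{111, …, 114}` and hence a gap, so `P` is not IDP. These long but gappy
fibres first occur in the third dilate and make `E_P(3)` large: summing the fibre lengths gives
`E_P(1) = 12`, `E_P(2) = 63` and `E_P(3) = 331`, and `12 * 331 > 63 ^ 2`.
-/

namespace LatticePolytope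

/-! ### Inequalities for the polytope -/

/-- The point `p` of `ℝ⁷` (or `ℤ⁷`) is a combination of total weight `k` of the columns of
`exampleMatrix` in which the two columns over the edge `{0, 1}` have total weight `s`.
Such an `s` determines the weights of the other five edges `{5, 0}`, `{1, 2}`, `{2, 3}`, `{3, 4}`,
`{4, 5}`, which are `p 0 - s`, `p 1 - s`, `s - (p 1 - p 2)`, and so on around the cycle; the first
inequalities say that all of them are nonnegative. The two columns over an edge differ by one in
height, so the height `p 6` ranges over `[111 * s, 111 * s + k]`. -/
def IsWeight {R : Type*} [CommRing R] [LinearOrder R] (k : R) (p : Fin 7 → R) (s : R) : Prop :=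
  p 0 + p 2 + p 4 = k ∧ p 1 + p 3 + p 5 = k ∧
  0 ≤ s ∧ p 1 - p 2 ≤ s ∧ p 1 - p 2 + p 3 - p 4 ≤ s ∧
  s ≤ p 0 ∧ s ≤ p 1 ∧ s ≤ p 1 - p 2 + p 3 ∧
  111 * s ≤ p 6 ∧ p 6 ≤ 111 * s + k

theorem mem_convexHull_range_iff {ι E : Type*} [Fintype ι] [AddCommGroup E] [Module ℝ E]
    (v : ι → E) (x : E) :
    x ∈ convexHull ℝ (Set.range v) ↔
      ∃ c : ι → ℝ, (∀ i, 0 ≤ c i) ∧ ∑ i, c i = 1 ∧ ∑ i, c i • v i = x := by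
  rw [convexHull_range_eq_exists_affineCombination]
  constructor
  · rintro ⟨s, w, h0, h1, rfl⟩
    classical
    refine ⟨fun i => if i ∈ s then w i else 0, fun i => ?_, ?_, ?_⟩
    · dsimp only; split_ifs with h
      exacts [h0 i h, le_rfl]
    · simpa using h1
    · simp [s.affineCombination_eq_linear_combination _ _ h1, ite_smul]
  · rintro ⟨c, h0, h1, rfl⟩
    exact ⟨Finset.univ, c, fun i _ => h0 i, h1,
      Finset.univ.affineCombination_eq_linear_combination _ _ h1⟩

theorem mem_examplePolytope_iff (p : Fin 7 → ℝ) :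
    p ∈ examplePolytope ↔ ∃ s, IsWeight 1 p s := by
  rw [examplePolytope, mem_convexHull_range_iff]
  constructor
  · rintro ⟨c, h0, h1, rfl⟩
    refine ⟨c 0 + c 1, ?_⟩
    simp only [Fin.forall_fin_succ] at h0
    simp [Fin.sum_univ_succ, toReal, exampleMatrix, IsWeight] at h0 h1 ⊢
    refine ⟨?_, ?_, ?_, ?_, ?_, ?_, ?_, ?_, ?_, ?_⟩ <;> linarith
  · rintro ⟨s, h1, h2, h3, h4, h5, h6, h7, h8, h9, h10⟩
    -- Every edge weight is split between its two columns in the ratio `1 - t : t`.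
    obtain ⟨t, ht⟩ : ∃ t, t = p 6 - 111 * s := ⟨_, rfl⟩
    have ht0 : 0 ≤ t := by linarith
    have ht1 : 0 ≤ 1 - t := by linarith
    let a : Fin 6 → ℝ := ![s, p 0 - s, p 1 - s, s - (p 1 - p 2), p 1 - p 2 + p 3 - s,
      s - (p 1 - p 2 + p 3 - p 4)]
    refine ⟨![a 0 * (1 - t), a 0 * t, a 1 * (1 - t), a 1 * t, a 2 * (1 - t), a 2 * t,
      a 3 * (1 - t), a 3 * t, a 4 * (1 - t), a 4 * t, a 5 * (1 - t), a 5 * t], ?_, ?_, ?_⟩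
    · have ha : ∀ i, 0 ≤ a i := by
        simp [Fin.forall_fin_succ, a]
        refine ⟨?_, ?_, ?_, ?_, ?_, ?_⟩ <;> linarith
      simp only [Fin.forall_fin_succ]
      simp [mul_nonneg, ha, ht0, ht1]
    · simp [Fin.sum_univ_succ, a]
      linear_combination h1
    · ext i
      fin_cases i <;> simp [Fin.sum_univ_succ, toReal, exampleMatrix, a]
      · ring
      · ring
      · ring
      · ring
      · ring
      · linear_combination h1 - h2
      · linear_combination ht + t * h1

theorem mem_smul_examplePolytope_iff {k : ℕ} (hk : 0 < k) (p : Fin 7 → ℝ) :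
    p ∈ (k : ℝ) • examplePolytope ↔ ∃ s, IsWeight (k : ℝ) p s := by
  have hk' : (0 : ℝ) < k := by exact_mod_cast hk
  rw [Set.mem_smul_set]
  constructor
  · rintro ⟨q, hq, rfl⟩
    obtain ⟨s, h1, h2, h3, h4, h5, h6, h7, h8, h9, h10⟩ := (mem_examplePolytope_iff q).1 hq
    refine ⟨k * s, ?_⟩
    simp only [IsWeight, Pi.smul_apply, smul_eq_mul]
    refine ⟨?_, ?_, ?_, ?_, ?_, ?_, ?_, ?_, ?_, ?_⟩
    · linear_combination (k : ℝ) * h1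
    · linear_combination (k : ℝ) * h2
    all_goals nlinarith
  · rintro ⟨s, h1, h2, h3, h4, h5, h6, h7, h8, h9, h10⟩
    refine ⟨(k : ℝ)⁻¹ • p, (mem_examplePolytope_iff _).2 ⟨(k : ℝ)⁻¹ * s, ?_⟩,
      smul_inv_smul₀ hk'.ne' p⟩
    have hi : (0 : ℝ) < (k : ℝ)⁻¹ := inv_pos.2 hk'
    have hki : (k : ℝ)⁻¹ * k = 1 := inv_mul_cancel₀ hk'.ne'
    simp only [IsWeight, Pi.smul_apply, smul_eq_mul]
    refine ⟨?_, ?_, ?_, ?_, ?_, ?_, ?_, ?_, ?_, ?_⟩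
    · linear_combination (k : ℝ)⁻¹ * h1 + hki
    · linear_combination (k : ℝ)⁻¹ * h2 + hki
    all_goals nlinarith

/-- The least weight of the edge `{0, 1}` in a nonnegative combination of edges equal to the
first six coordinates of `p`, when there is such a combination. -/
def lower {R : Type*} [CommRing R] [LinearOrder R] (p : Fin 7 → R) : R :=
  max 0 (max (p 1 - p 2) (p 1 - p 2 + p 3 - p 4))

/-- The greatest weight of the edge `{0, 1}` in a nonnegative combination of edges equal to the
first six coordinates of `p`, when there is such a combination. -/
def upper {R : Type*} [CommRing R] [LinearOrder R] (p : Fin 7 → R) : R :=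
  min (p 0) (min (p 1) (p 1 - p 2 + p 3))

theorem exists_isWeight_iff (k : ℝ) (hk : 0 ≤ k) (p : Fin 7 → ℝ) :
    (∃ s, IsWeight k p s) ↔ p 0 + p 2 + p 4 = k ∧ p 1 + p 3 + p 5 = k ∧
      lower p ≤ upper p ∧ 111 * lower p ≤ p 6 ∧ p 6 ≤ 111 * upper p + k := by
  constructor
  · rintro ⟨s, h1, h2, h3, h4, h5, h6, h7, h8, h9, h10⟩
    have hl : lower p ≤ s := max_le h3 (max_le h4 h5)
    have hu : s ≤ upper p := le_min h6 (le_min h7 h8)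
    exact ⟨h1, h2, hl.trans hu, by linarith, by linarith⟩
  · rintro ⟨h1, h2, h3, h4, h5⟩
    -- This is the least weight compatible with the lower bound and with the height.
    refine ⟨max (lower p) ((p 6 - k) / 111), h1, h2, ?_⟩
    have hs : max (lower p) ((p 6 - k) / 111) ≤ upper p := max_le h3 (by linarith)
    obtain ⟨hl, hr⟩ := max_le_iff.1 (le_refl (max (lower p) ((p 6 - k) / 111)))
    obtain ⟨hl1, hl23⟩ := max_le_iff.1 hl
    obtain ⟨hl2, hl3⟩ := max_le_iff.1 hl23
    obtain ⟨hu1, hu23⟩ := le_min_iff.1 hs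
    obtain ⟨hu2, hu3⟩ := le_min_iff.1 hu23
    refine ⟨hl1, hl2, hl3, hu1, hu2, hu3, ?_, by linarith⟩
    rw [mul_max_of_nonneg _ _ (by norm_num)]
    exact max_le h4 (by linarith)

/-! ### Lattice points of the dilates -/

theorem lower_toReal (z : Fin 7 → ℤ) : lower (toReal z) = ((lower z : ℤ) : ℝ) := by
  simp [lower, toReal]

theorem upper_toReal (z : Fin 7 → ℤ) : upper (toReal z) = ((upper z : ℤ) : ℝ) := by
  simp [upper, toReal]

theorem mem_latticePoints_smul_iff {k : ℕ} (hk : 0 < k) (z : Fin 7 → ℤ) :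
    z ∈ latticePoints ((k : ℝ) • examplePolytope) ↔
      z 0 + z 2 + z 4 = k ∧ z 1 + z 3 + z 5 = k ∧
      lower z ≤ upper z ∧ 111 * lower z ≤ z 6 ∧ z 6 ≤ 111 * upper z + k := by
  rw [latticePoints, Set.mem_ofPred_eq, mem_smul_examplePolytope_iff hk,
    exists_isWeight_iff _ (by positivity), lower_toReal, upper_toReal]
  simp only [toReal]
  norm_cast

theorem mem_latticePoints_iff (z : Fin 7 → ℤ) :
    z ∈ latticePoints examplePolytope ↔
      z 0 + z 2 + z 4 = 1 ∧ z 1 + z 3 + z 5 = 1 ∧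
      lower z ≤ upper z ∧ 111 * lower z ≤ z 6 ∧ z 6 ≤ 111 * upper z + 1 := by
  simpa using mem_latticePoints_smul_iff one_pos z

/-! ### Very ampleness and failure of the integer decomposition property -/

/-- A lattice point with an *integral* weight for the edge `{0, 1}` decomposes: some edge has
positive weight, and one of its two columns can be split off. -/
theorem exists_sum_of_isWeight {k : ℕ} {z : Fin 7 → ℤ} {s : ℤ} (h : IsWeight (k : ℤ) z s) :
    ∃ p : Fin k → (Fin 7 → ℤ), (∀ i, p i ∈ latticePoints examplePolytope) ∧ z = ∑ i, p i := by
  induction k generalizing z s with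
  | zero =>
    refine ⟨Fin.elim0, fun i => i.elim0, ?_⟩
    ext i
    simp only [IsWeight] at h
    push_cast at h
    fin_cases i <;> simp <;> omega
  | succ k ih =>
    have key : ∃ (c : Fin 7 → ℤ) (t : ℤ),
        c ∈ latticePoints examplePolytope ∧ IsWeight (k : ℤ) (z - c) t := by
      -- `d` selects the upper column of the edge unless the height is already minimal.
      obtain ⟨d, hd⟩ : ∃ d : ℤ, 0 ≤ d ∧ d ≤ 1 ∧ d ≤ z 6 - 111 * s ∧
          z 6 - 111 * s - d ≤ k := by
        simp only [IsWeight] at h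
        push_cast at h
        exact ⟨min 1 (z 6 - 111 * s), by omega⟩
      have hcase : 1 ≤ s ∨ 1 ≤ z 0 - s ∨ 1 ≤ z 1 - s ∨ 1 ≤ s - (z 1 - z 2) ∨
          1 ≤ z 1 - z 2 + z 3 - s ∨ 1 ≤ s - (z 1 - z 2 + z 3 - z 4) := by
        simp only [IsWeight] at h
        push_cast at h
        omega
      -- The columns over `{0, 1}`, `{5, 0}`, `{1, 2}`, `{2, 3}`, `{3, 4}`, `{4, 5}` in turn.
      simp only [mem_latticePoints_iff, IsWeight, lower, upper, Pi.sub_apply]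
      simp only [IsWeight] at h
      push_cast at h
      rcases hcase with hc | hc | hc | hc | hc | hc
      · exact ⟨![1, 1, 0, 0, 0, 0, 111 + d], s - 1, by simp; omega, by simp; omega⟩
      · exact ⟨![1, 0, 0, 0, 0, 1, d], s, by simp; omega, by simp; omega⟩
      · exact ⟨![0, 1, 1, 0, 0, 0, d], s, by simp; omega, by simp; omega⟩
      · exact ⟨![0, 0, 1, 1, 0, 0, d], s, by simp; omega, by simp; omega⟩
      · exact ⟨![0, 0, 0, 1, 1, 0, d], s, by simp; omega, by simp; omega⟩
      · exact ⟨![0, 0, 0, 0, 1, 1, d], s, by simp; omega, by simp; omega⟩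
    obtain ⟨c, t, hc, ht⟩ := key
    obtain ⟨p, hp, hz⟩ := ih ht
    refine ⟨Fin.cons c p, fun i => ?_, ?_⟩
    · refine Fin.cases ?_ (fun i => ?_) i
      · simpa using hc
      · simpa using hp i
    · rw [Fin.sum_univ_succ]
      simp [← hz]

/-- An integral weight `s` yields the heights `111 * s, …, 111 * s + k`. For `k ≥ 110` consecutive
ranges leave no gap between them, so every lattice point of the dilate has an integral weight. -/
theorem isVeryAmple_examplePolytope : IsVeryAmple examplePolytope := by
  refine ⟨110, fun k hk z hz => ?_⟩
  rw [mem_latticePoints_smul_iff (by omega)] at hz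
  refine exists_sum_of_isWeight (s := min (upper z) (z 6 / 111)) ?_
  simp only [IsWeight, lower, upper] at hz ⊢
  omega

/-- The all-ones vector decomposes into three edges in two ways only, giving the heights
`0, …, 3` and `111, …, 114`; height `50` lies in `3P` but in neither range. -/
theorem not_isIDP_examplePolytope : ¬ IsIDP examplePolytope := by
  intro h
  obtain ⟨p, hp, hz⟩ := h 3 (by norm_num) ![1, 1, 1, 1, 1, 1, 50]
    ((mem_latticePoints_smul_iff (by norm_num) _).2 (by simp [lower, upper]))
  -- Over a single edge the weight of `{0, 1}` is unique, so `lower` and `upper` agree.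
  have key : ∀ i, ∃ s : ℤ, 111 * s ≤ p i 6 ∧ p i 6 ≤ 111 * s + 1 := by
    intro i
    have hi := (mem_latticePoints_iff _).1 (hp i)
    refine ⟨lower (p i), hi.2.2.2.1, ?_⟩
    simp only [lower, upper] at hi ⊢
    omega
  obtain ⟨s0, h0⟩ := key 0
  obtain ⟨s1, h1⟩ := key 1
  obtain ⟨s2, h2⟩ := key 2
  have h6 := congrFun hz 6
  simp [Fin.sum_univ_succ] at h6
  omega

/-! ### Counting lattice points -/

/-- The point of `ℤ⁷` of height `h` over the lattice point of `kQ` whose first four coordinates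
are `q`; the last two are forced, since the even-indexed and the odd-indexed coordinates each
sum to `k`. -/
def point (k : ℤ) (q : ℤ × ℤ × ℤ × ℤ) (h : ℤ) : Fin 7 → ℤ :=
  ![q.1, q.2.1, q.2.2.1, q.2.2.2, k - q.1 - q.2.2.1, k - q.2.1 - q.2.2.2, h]

/-- The lattice points of `kQ`, encoded by their first four coordinates. Nonnegativity and
`lower ≤ upper` make the remaining two coordinates nonnegative, so the box `[0, k]⁴` suffices. -/
noncomputable def baseLatticePoints (k : ℕ) : Finset (ℤ × ℤ × ℤ × ℤ) :=
  (Finset.Icc 0 (k : ℤ) ×ˢ Finset.Icc 0 (k : ℤ) ×ˢ Finset.Icc 0 (k : ℤ) ×ˢ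
    Finset.Icc 0 (k : ℤ)).filter fun q => lower (point k q 0) ≤ upper (point k q 0)

/-- The lattice points of `kP` are counted fibre by fibre over those of `kQ`. -/
theorem ehrhart_examplePolytope {k : ℕ} (hk : 0 < k) :
    ehrhart examplePolytope k =
      ∑ q ∈ baseLatticePoints k,
        (111 * upper (point k q 0) + k + 1 - 111 * lower (point k q 0)).toNat := by
  let T : Finset (Σ _ : ℤ × ℤ × ℤ × ℤ, ℤ) := (baseLatticePoints k).sigma fun q =>
    Finset.Icc (111 * lower (point k q 0)) (111 * upper (point k q 0) + k)
  have hT : latticePoints ((k : ℝ) • examplePolytope) =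
      (fun x : (Σ _ : ℤ × ℤ × ℤ × ℤ, ℤ) => point k x.1 x.2) '' (T : Set _) := by
    ext z
    rw [mem_latticePoints_smul_iff hk]
    constructor
    · intro h
      refine ⟨⟨(z 0, z 1, z 2, z 3), z 6⟩, ?_, ?_⟩
      · simp only [T, baseLatticePoints, point, lower, upper, Finset.coe_sigma, Set.mem_sigma_iff,
          Finset.mem_coe, Finset.mem_Icc] at h ⊢
        simp
        omega
      · ext i
        fin_cases i <;> simp [point] <;> omega
    · rintro ⟨⟨⟨a, b, c, d⟩, e⟩, h, rfl⟩
      simp only [T, baseLatticePoints, point, lower, upper, Finset.coe_sigma, Set.mem_sigma_iff,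
          Finset.mem_coe, Finset.mem_Icc] at h ⊢
      simp at h ⊢
      omega
  have hinj : Function.Injective
      (fun x : (Σ _ : ℤ × ℤ × ℤ × ℤ, ℤ) => point k x.1 x.2) := by
    rintro ⟨⟨a, b, c, d⟩, e⟩ ⟨⟨a', b', c', d'⟩, e'⟩ h
    have := congrFun h
    simp [point, Fin.forall_fin_succ] at this
    simp [this]
  rw [ehrhart, hT, Set.ncard_image_of_injective _ hinj, Set.ncard_coe_finset,
    Finset.card_sigma]
  simp only [Int.card_Icc]

/-- Log-concavity fails at the second dilate: `12 * 331 = 3972 > 3969 = 63 ^ 2`. -/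
theorem not_ehrhartSeriesLogConcave_examplePolytope :
    ¬ EhrhartSeriesLogConcave examplePolytope := by
  have h1 : ehrhart examplePolytope 1 = 12 := by
    rw [ehrhart_examplePolytope one_pos]; decide +kernel
  have h2 : ehrhart examplePolytope 2 = 63 := by
    rw [ehrhart_examplePolytope two_pos]; decide +kernel
  have h3 : ehrhart examplePolytope 3 = 331 := by
    rw [ehrhart_examplePolytope three_pos]; decide +kernel
  intro h
  have := h.2 1
  norm_num [h1, h2, h3] at this

/-! ### The segmental fibration over the edge polytope -/

theorem isLatticePolytope_examplePolytope : IsLatticePolytope examplePolytope := by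
  refine ⟨Finset.univ.image fun j : Fin 12 => fun i => exampleMatrix i j, by simp, ?_⟩
  rw [examplePolytope, Finset.coe_image, Finset.coe_univ, Set.image_univ, ← Set.range_comp]
  rfl

theorem isLatticePolytope_edgePolytope {n : ℕ} (G : SimpleGraph (Fin n)) {i j : Fin n}
    (hij : G.Adj i j) : IsLatticePolytope (edgePolytope G) := by
  classical
  refine ⟨(Finset.univ.filter fun e : Fin n × Fin n => G.Adj e.1 e.2).image
    fun e => Pi.single e.1 1 + Pi.single e.2 1,
    ⟨_, Finset.mem_image_of_mem _ (a := (i, j)) (by simpa using hij)⟩, ?_⟩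
  rw [edgePolytope]
  congr 1
  have hs : ∀ a b : Fin n, toReal (Pi.single a 1 + Pi.single b 1) =
      Pi.single a 1 + Pi.single b 1 := by
    intro a b
    ext x
    simp [toReal, Pi.single_apply]
  ext v
  simp [hs, eq_comm]

theorem forgetLast_toReal {n : ℕ} (z : Fin (n + 1) → ℤ) :
    forgetLast n (toReal z) = toReal fun i => z i.castSucc := rfl

theorem image_examplePolytope :
    forgetLast 6 '' examplePolytope = edgePolytope (SimpleGraph.cycleGraph 6) := by
  rw [examplePolytope, AffineMap.image_convexHull, edgePolytope, ← Set.range_comp]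
  congr 1
  ext v
  constructor
  · rintro ⟨j, rfl⟩
    have : ∃ a b : Fin 6, (SimpleGraph.cycleGraph 6).Adj a b ∧
        (fun i : Fin 6 => exampleMatrix i.castSucc j) = Pi.single a 1 + Pi.single b 1 := by
      revert j; decide +kernel
    obtain ⟨a, b, hab, h⟩ := this
    refine ⟨a, b, hab, ?_⟩
    ext x
    have hx := congrFun h x
    simp only [Pi.add_apply, Pi.single_apply] at hx
    simp [forgetLast_toReal, hx, toReal, Pi.single_apply]
  · rintro ⟨a, b, hab, rfl⟩
    have : ∃ j : Fin 12,
        (fun i : Fin 6 => exampleMatrix i.castSucc j) = Pi.single a 1 + Pi.single b 1 := by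
      revert a b; decide +kernel
    obtain ⟨j, h⟩ := this
    refine ⟨j, ?_⟩
    ext x
    have hx := congrFun h x
    simp only [Pi.add_apply, Pi.single_apply] at hx
    simp [forgetLast_toReal, hx, toReal, Pi.single_apply]

theorem lower_eq_of_forgetLast_eq {p q : Fin 7 → ℝ} (h : forgetLast 6 p = forgetLast 6 q) :
    lower p = lower q := by
  have h' : ∀ i : Fin 6, p i.castSucc = q i.castSucc := congrFun h
  have h1 : p 1 = q 1 := h' 1
  have h2 : p 2 = q 2 := h' 2
  have h3 : p 3 = q 3 := h' 3
  have h4 : p 4 = q 4 := h' 4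
  simp only [lower, h1, h2, h3, h4]

theorem upper_eq_of_forgetLast_eq {p q : Fin 7 → ℝ} (h : forgetLast 6 p = forgetLast 6 q) :
    upper p = upper q := by
  have h' : ∀ i : Fin 6, p i.castSucc = q i.castSucc := congrFun h
  have h0 : p 0 = q 0 := h' 0
  have h1 : p 1 = q 1 := h' 1
  have h2 : p 2 = q 2 := h' 2
  have h3 : p 3 = q 3 := h' 3
  simp only [upper, h0, h1, h2, h3]

theorem forgetLast_snoc {n : ℕ} (w : Fin n → ℤ) (h : ℤ) :
    forgetLast n (toReal (Fin.snoc w h : Fin (n + 1) → ℤ)) = toReal w := by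
  ext i
  simp [forgetLast_toReal, toReal]

/-- The points over `w` with last coordinate in `[a, b]` form a segment with lattice endpoints. -/
theorem setOf_forgetLast_eq_segment {n : ℕ} (w : Fin n → ℤ) {a b : ℤ} (hab : a < b) :
    {p | forgetLast n p = toReal w ∧ (a : ℝ) ≤ p (Fin.last n) ∧ p (Fin.last n) ≤ b} =
      segment ℝ (toReal (Fin.snoc w a : Fin (n + 1) → ℤ)) (toReal (Fin.snoc w b)) := by
  have hab' : (0 : ℝ) < b - a := by exact_mod_cast sub_pos.2 hab
  rw [segment_eq_image]
  ext p
  constructor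
  · rintro ⟨hw, ha, hb⟩
    refine ⟨(p (Fin.last n) - a) / (b - a), ⟨by apply div_nonneg <;> linarith,
      by rw [div_le_one hab']; linarith⟩, ?_⟩
    ext i
    refine Fin.lastCases ?_ (fun i => ?_) i
    · simp [toReal]
      field_simp
      ring
    · have := congrFun hw i
      simp [toReal] at this ⊢
      rw [show p i.castSucc = w i from this]
      ring
  · rintro ⟨t, ⟨h0, h1⟩, rfl⟩
    refine ⟨?_, ?_, ?_⟩
    · ext i
      simp [forgetLast, LinearMap.funLeft, toReal]
      ring
    · simp [toReal]
      nlinarith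
    · simp [toReal]
      nlinarith

theorem isSegmentalFibration_examplePolytope :
    IsSegmentalFibration (forgetLast 6) examplePolytope
      (edgePolytope (SimpleGraph.cycleGraph 6)) where
  isLatticePolytope_total := isLatticePolytope_examplePolytope
  isLatticePolytope_base :=
    isLatticePolytope_edgePolytope _ (i := 0) (j := 1) (by decide)
  image_eq := image_examplePolytope
  map_lattice z hz := by
    refine ⟨fun i => z i.castSucc, ?_, forgetLast_toReal z⟩
    rw [← image_examplePolytope]
    exact ⟨_, hz, forgetLast_toReal z⟩
  fibre w hw := by
    rw [← image_examplePolytope] at hw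
    obtain ⟨q, hq, hqw⟩ := hw
    obtain ⟨h1, h2, hle, -, -⟩ :=
      (exists_isWeight_iff 1 zero_le_one q).1 ((mem_examplePolytope_iff q).1 hq)
    have hsnoc := forgetLast_snoc w 0
    set b : Fin 7 → ℤ := Fin.snoc w 0
    rw [lower_eq_of_forgetLast_eq (hqw.trans hsnoc.symm), lower_toReal,
      upper_eq_of_forgetLast_eq (hqw.trans hsnoc.symm), upper_toReal, Int.cast_le] at hle
    have hlt : 111 * lower b < 111 * upper b + 1 := by omega
    refine ⟨Fin.snoc w (111 * lower b), Fin.snoc w (111 * upper b + 1), fun h => ?_, ?_⟩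
    · have := congrFun h (Fin.last 6)
      simp only [Fin.snoc_last] at this
      exact hlt.ne this
    rw [← setOf_forgetLast_eq_segment w hlt]
    ext p
    simp only [Set.mem_ofPred_eq]
    rw [and_comm]
    refine and_congr_right fun hp => ?_
    have hpq : ∀ i : Fin 6, p i.castSucc = q i.castSucc := congrFun (hp.trans hqw.symm)
    rw [mem_examplePolytope_iff, exists_isWeight_iff 1 zero_le_one,
      lower_eq_of_forgetLast_eq (hp.trans hsnoc.symm), lower_toReal,
      upper_eq_of_forgetLast_eq (hp.trans hsnoc.symm), upper_toReal]
    have e1 : p 0 + p 2 + p 4 = 1 := by rw [← h1]; exact congr($(hpq 0) + $(hpq 2) + $(hpq 4))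
    have e2 : p 1 + p 3 + p 5 = 1 := by rw [← h2]; exact congr($(hpq 1) + $(hpq 3) + $(hpq 5))
    push_cast
    exact ⟨fun h => h.2.2.2, fun h => ⟨e1, e2, by exact_mod_cast hle, h⟩⟩

end LatticePolytope

theorem mainTheorem11 :
    (∃ (n : ℕ) (P : Set (Fin n → ℝ)),
      LatticePolytope.IsLatticePolytope P ∧
      LatticePolytope.IsVeryAmple P ∧
      ¬ LatticePolytope.EhrhartSeriesLogConcave P) ∧
    LatticePolytope.IsLatticePolytope LatticePolytope.examplePolytope ∧
    LatticePolytope.IsVeryAmple LatticePolytope.examplePolytope ∧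
    ¬ LatticePolytope.IsIDP LatticePolytope.examplePolytope ∧
    LatticePolytope.IsSegmentalFibration (LatticePolytope.forgetLast 6)
      LatticePolytope.examplePolytope
      (LatticePolytope.edgePolytope (SimpleGraph.cycleGraph 6)) ∧
    ¬ LatticePolytope.EhrhartSeriesLogConcave LatticePolytope.examplePolytope :=
  ⟨⟨7, LatticePolytope.examplePolytope, LatticePolytope.isLatticePolytope_examplePolytope,
      LatticePolytope.isVeryAmple_examplePolytope,
      LatticePolytope.not_ehrhartSeriesLogConcave_examplePolytope⟩,
    LatticePolytope.isLatticePolytope_examplePolytope,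
    LatticePolytope.isVeryAmple_examplePolytope,
    LatticePolytope.not_isIDP_examplePolytope,
    LatticePolytope.isSegmentalFibration_examplePolytope,
    LatticePolytope.not_ehrhartSeriesLogConcave_examplePolytope⟩
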